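/- All Banach spaces are real, and $B_X$ denotes the closed unit ball of $X$. For a nonempty bounded set $C\subseteq X$, a slice of $C$ is a set $S(C,f,\alpha)=\{x\in C: f(x)>\sup_C f-\alpha\}$ with $f\in X^*$, $f\neq 0$, and $\alpha>0$. A convex combination of slices of $C$ is a Minkowski sum $\sum_{i=1}^n\lambda_i S_i$, where $n\ge 1$, $\lambda_i\ge 0$, $\sum_{i=1}^n\lambda_i=1$ and each $S_i$ is a slice of $C$. The space $X$ has the slice diameter two property (slice-D2P), respectively the diameter two property (D2P), respectively the strong diameter two property (strong D2P), if every slice of $B_X$, respectively every nonempty relatively weakly open subset of $B_X$, respectively every convex combination of slices of $B_X$, has diameter $2$. A closed bounded convex set $C$ in a Banach space is strongly regular if every closed convex subset of $C$ with at least two points has, for each $\varepsilon>0$, a convex combination of slices of diameter less than $\varepsilon$; a Banach space is strongly regular if all of its closed bounded convex subsets are. **Theorem.** Let $X$ be a Banach space and let $Y$ be a closed subspace of $X$. (i) If $X$ has the slice-D2P and there is a continuous linear projection $\pi:X\to Y$ of $X$ onto $Y$ with $\|\pi\|=1$ and $\ker\pi$ finite-dimensional, then $Y$ has the slice-D2P.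 (ii) If $X$ has the D2P and $X/Y$ is finite-dimensional, then $Y$ has the D2P. (iii) If $X$ has the strong D2P and $X/Y$ is strongly regular, then $Y$ has the strong D2P. -/

import Mathlib

namespace DiameterTwo

section Definitions

variable {E : Type*} [NormedAddCommGroup E] [NormedSpace ℝ E]

/-- The slice `S(C, f, α) = {x ∈ C : f x > sup_C f - α}`. It is used for nonempty bounded sets `C`,
on which the supremum is an honest one. -/
def slice (C : Set E) (f : StrongDual ℝ E) (α : ℝ) : Set E :=
  {x ∈ C | sSup (f '' C) - α < f x}

/-- `S` is a slice of `C`, determined by a nonzero functional and a positive number. -/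
def IsSlice (C S : Set E) : Prop :=
  ∃ f : StrongDual ℝ E, f ≠ 0 ∧ ∃ α : ℝ, 0 < α ∧ S = slice C f α

/-- `T` is a convex combination `∑ i, w i • S i` (Minkowski sum) of finitely many slices `S i`
of `C`. -/
def IsConvexCombinationOfSlices (C T : Set E) : Prop :=
  ∃ (n : ℕ) (w : Fin n → ℝ) (S : Fin n → Set E),
    (∀ i, 0 ≤ w i) ∧ ∑ i, w i = 1 ∧ (∀ i, IsSlice C (S i)) ∧
      T = {z | ∃ x : Fin n → E, (∀ i, x i ∈ S i) ∧ z = ∑ i, w i • x i}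

variable (E) in
/-- The slice diameter two property: every slice of the closed unit ball has diameter `2`. -/
def SliceD2P : Prop :=
  ∀ S : Set E, IsSlice (Metric.closedBall (0 : E) 1) S → Metric.diam S = 2

variable (E) in
/-- The diameter two property: every nonempty relatively weakly open subset of the closed unit
ball has diameter `2`. -/
def D2P : Prop :=
  ∀ U : Set (WeakSpace ℝ E), IsOpen U →
    (toWeakSpace ℝ E ⁻¹' U ∩ Metric.closedBall (0 : E) 1).Nonempty →
      Metric.diam (toWeakSpace ℝ E ⁻¹' U ∩ Metric.closedBall (0 : E) 1) = 2

variable (E) in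
/-- The strong diameter two property: every convex combination of slices of the closed unit ball
has diameter `2`. -/
def StrongD2P : Prop :=
  ∀ T : Set E, IsConvexCombinationOfSlices (Metric.closedBall (0 : E) 1) T → Metric.diam T = 2

/-- A closed, bounded, convex set `C` is strongly regular if every closed convex subset `D` has
convex combinations of slices of arbitrarily small diameter. Only sets `D` with at least two points
are mentioned: a one-point set in a nonzero space is a slice of itself, of diameter `0`, and the
zero space, which has no nonzero functionals, is thereby counted as strongly regular. -/
def IsStronglyRegular (C : Set E) : Prop :=
  IsClosed C ∧ Bornology.IsBounded C ∧ Convex ℝ C ∧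
    ∀ D ⊆ C, D.Nontrivial → IsClosed D → Convex ℝ D →
      ∀ ε : ℝ, 0 < ε → ∃ T : Set E, IsConvexCombinationOfSlices D T ∧ Metric.diam T < ε

variable (E) in
/-- A space is strongly regular if all its closed, bounded, convex subsets are. -/
def StronglyRegularSpace : Prop :=
  ∀ C : Set E, IsClosed C → Bornology.IsBounded C → Convex ℝ C → IsStronglyRegular C

end Definitions

end DiameterTwo

namespace DiameterTwo

/-! Large sets in the ball of `X` are moved to the ball of `Y` with little change in distances, so
points at distance almost 2 survive.

For (i), a slice of the ball of `Y` pulls back along `π`. `exists_cap_norm_sub_le` shrinks the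
result to a slice on which `x - π x` barely varies, so `π` almost preserves distances there.

For (ii) and (iii), a point of the ball of `X` with small class in `X ⧸ Y` is close to the ball of
`Y` (`exists_mem_closedBall_norm_sub_le`). In (ii) small class is a weakly open condition. In (iii)
a convex combination of slices with small class must be found inside a given slice. The points
approximable by images of such combinations form a convex set, and strong regularity of the quotient
prevents Hahn–Banach from separating anything from its closure
(`exists_containsCapCombination_near`). -/

variable {E Z K : Type*} [NormedAddCommGroup E] [NormedSpace ℝ E]
  [NormedAddCommGroup Z] [NormedSpace ℝ Z] [NormedAddCommGroup K] [NormedSpace ℝ K]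

/-- The part of `C` on which `f` exceeds `a`. Unlike for a slice, the functional `f` may vanish. -/
def cap (C : Set E) (f : StrongDual ℝ E) (a : ℝ) : Set E :=
  {x ∈ C | a < f x}

theorem convex_cap {C : Set E} (hC : Convex ℝ C) (f : StrongDual ℝ E) (a : ℝ) :
    Convex ℝ (cap C f a) :=
  hC.inter (convex_halfSpace_gt f.toLinearMap.isLinear a)

/-- The Minkowski sum `∑ i, w i • S i`. -/
def minkowskiSum {ι : Type*} [Fintype ι] (w : ι → ℝ) (S : ι → Set E) : Set E :=
  {z | ∃ x : ι → E, (∀ i, x i ∈ S i) ∧ z = ∑ i, w i • x i}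

/-- `T` contains a convex combination of nonempty caps of `C`. -/
def ContainsCapCombination (C T : Set E) : Prop :=
  ∃ (ι : Type) (_ : Fintype ι) (w : ι → ℝ) (f : ι → StrongDual ℝ E) (a : ι → ℝ),
    (∀ i, 0 ≤ w i) ∧ ∑ i, w i = 1 ∧ (∀ i, (cap C (f i) (a i)).Nonempty) ∧
      minkowskiSum w (fun i => cap C (f i) (a i)) ⊆ T

theorem minkowskiSum_nonempty {ι : Type*} [Fintype ι] {w : ι → ℝ} {S : ι → Set E}
    (h : ∀ i, (S i).Nonempty) : (minkowskiSum w S).Nonempty := by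
  choose x hx using h
  exact ⟨_, x, hx, rfl⟩

theorem minkowskiSum_subset_of_convex {ι : Type*} [Fintype ι] {w : ι → ℝ} {S : ι → Set E}
    {C : Set E} (hC : Convex ℝ C) (hw : ∀ i, 0 ≤ w i) (hw1 : ∑ i, w i = 1)
    (h : ∀ i, S i ⊆ C) : minkowskiSum w S ⊆ C := by
  rintro _ ⟨x, hx, rfl⟩
  exact hC.sum_mem (fun i _ => hw i) hw1 (fun i _ => h i (hx i))

theorem ContainsCapCombination.nonempty {C T : Set E} (h : ContainsCapCombination C T) :
    T.Nonempty := by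
  obtain ⟨ι, _, w, f, a, -, -, hne, hT⟩ := h
  exact (minkowskiSum_nonempty hne).mono hT

theorem ContainsCapCombination.mono {C T T' : Set E} (h : ContainsCapCombination C T)
    (hT : T ⊆ T') : ContainsCapCombination C T' := by
  obtain ⟨ι, i, w, f, a, h1, h2, h3, h4⟩ := h
  exact ⟨ι, i, w, f, a, h1, h2, h3, h4.trans hT⟩

theorem containsCapCombination_cap {C : Set E} {f : StrongDual ℝ E} {a : ℝ}
    (h : (cap C f a).Nonempty) : ContainsCapCombination C (cap C f a) := by
  refine ⟨Unit, inferInstance, fun _ => 1, fun _ => f, fun _ => a, by simp, by simp,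
    fun _ => h, ?_⟩
  rintro _ ⟨x, hx, rfl⟩
  simpa using hx ()

theorem ContainsCapCombination.minkowskiSum {C : Set E} {ι : Type} [Fintype ι] {w : ι → ℝ}
    {T : ι → Set E} (hw : ∀ i, 0 ≤ w i) (hw1 : ∑ i, w i = 1)
    (hT : ∀ i, ContainsCapCombination C (T i)) :
    ContainsCapCombination C (DiameterTwo.minkowskiSum w T) := by
  choose κ inst v f a hv hv1 hne hsub using hT
  refine ⟨Σ i, κ i, inferInstance, fun p => w p.1 * v p.1 p.2, fun p => f p.1 p.2,
    fun p => a p.1 p.2, fun p => mul_nonneg (hw _) (hv _ _), ?_, fun p => hne _ _, ?_⟩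
  · simp [Fintype.sum_sigma, ← Finset.mul_sum, hv1, hw1]
  · rintro _ ⟨x, hx, rfl⟩
    refine ⟨fun i => ∑ j, v i j • x ⟨i, j⟩, fun i => hsub i ⟨_, fun j => hx ⟨i, j⟩, rfl⟩, ?_⟩
    simp [Fintype.sum_sigma, Finset.smul_sum, mul_smul]

/-! ### Locating convex combinations of caps near a point -/

/-- If the image under `P` of every cap of `C` defined by a functional factoring through `P` meets
small balls in large sets, then so does every neighbourhood of every point of `P '' C`. -/
theorem exists_containsCapCombination_near {B C : Set E} (hC : Convex ℝ C) (P : E →L[ℝ] Z)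
    (h : ∀ (g : StrongDual ℝ Z) (a : ℝ), (cap C (g.comp P) a).Nonempty → ∀ δ > 0,
      ∃ T ⊆ cap C (g.comp P) a, ContainsCapCombination B T ∧ ∃ k, ∀ x ∈ T, ‖P x - k‖ ≤ δ)
    {c : E} (hc : c ∈ C) {δ : ℝ} (hδ : 0 < δ) :
    ∃ T ⊆ C, ContainsCapCombination B T ∧ ∀ x ∈ T, ‖P x - P c‖ ≤ δ := by
  -- `Q` collects the approximable points. Averaging two witnessing sets keeps the error, so `Q` is
  -- convex.
  let Q : Set Z := {k | ∃ T ⊆ C, ContainsCapCombination B T ∧ ∀ x ∈ T, ‖P x - k‖ ≤ δ / 2}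
  have hQ : Convex ℝ Q := by
    rintro k ⟨T, hTC, hT, hk⟩ l ⟨S, hSC, hS, hl⟩ a b ha hb hab
    have hw : ∀ i, 0 ≤ (![a, b] : Fin 2 → ℝ) i := by simp [Fin.forall_fin_two, ha, hb]
    have hw1 : ∑ i, (![a, b] : Fin 2 → ℝ) i = 1 := by simpa using hab
    refine ⟨minkowskiSum ![a, b] ![T, S],
      minkowskiSum_subset_of_convex hC hw hw1 (by simp [Fin.forall_fin_two, hTC, hSC]),
      .minkowskiSum hw hw1 (by simp [Fin.forall_fin_two, hT, hS]), ?_⟩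
    rintro _ ⟨x, hx, rfl⟩
    have h0 := hk (x 0) (hx 0)
    have h1 := hl (x 1) (hx 1)
    have e : P (∑ i, (![a, b] : Fin 2 → ℝ) i • x i) - (a • k + b • l)
        = a • (P (x 0) - k) + b • (P (x 1) - l) := by
      simp [Fin.sum_univ_two, smul_sub]; abel
    rw [e]
    calc _ ≤ ‖a • (P (x 0) - k)‖ + ‖b • (P (x 1) - l)‖ := norm_add_le _ _
      _ = a * ‖P (x 0) - k‖ + b * ‖P (x 1) - l‖ := by
        rw [norm_smul, norm_smul, Real.norm_of_nonneg ha, Real.norm_of_nonneg hb]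
      _ ≤ a * (δ / 2) + b * (δ / 2) := by gcongr
      _ = δ / 2 := by rw [← add_mul, hab, one_mul]
  have hmem : P c ∈ closure Q := by
    -- A separating `g` cuts off a cap around `c`. The hypothesis puts a point of `Q` in its image,
    -- on the wrong side of `g`.
    by_contra hn
    obtain ⟨g, u, hg, hu⟩ := geometric_hahn_banach_closed_point hQ.closure isClosed_closure hn
    obtain ⟨T, hTC, hT, k, hk⟩ := h g u ⟨c, hc, hu⟩ (δ / 4) (by linarith)
    obtain ⟨x, hx⟩ := hT.nonempty
    have hxQ : P x ∈ Q := by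
      refine ⟨T, fun y hy => (hTC hy).1, hT, fun y hy => ?_⟩
      have := norm_sub_le_norm_sub_add_norm_sub (P y) k (P x)
      rw [norm_sub_rev k] at this
      linarith [hk y hy, hk x hx]
    exact lt_asymm (hg _ (subset_closure hxQ)) (hTC hx).2
  obtain ⟨k, ⟨T, hTC, hT, hk⟩, hck⟩ := Metric.mem_closure_iff.1 hmem (δ / 2) (by linarith)
  refine ⟨T, hTC, hT, fun x hx => ?_⟩
  have := norm_sub_le_norm_sub_add_norm_sub (P x) k (P c)
  rw [dist_eq_norm, norm_sub_rev] at hck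
  linarith [hk x hx]

/-- Every nonempty cap of a bounded set contains a cap on which a finite-rank operator oscillates
little: by Rademacher's theorem, `φ ↦ sup_B (f + φ ∘ P)` is differentiable at points near `0`. -/
theorem exists_cap_norm_sub_le [FiniteDimensional ℝ K] {B : Set E} (hB : Bornology.IsBounded B)
    (P : E →L[ℝ] K) {f : StrongDual ℝ E} {a : ℝ} (hne : (cap B f a).Nonempty) {δ : ℝ}
    (hδ : 0 < δ) :
    ∃ (f' : StrongDual ℝ E) (a' : ℝ), (cap B f' a').Nonempty ∧ cap B f' a' ⊆ cap B f a ∧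
      ∀ x ∈ cap B f' a', ∀ y ∈ cap B f' a', ‖P x - P y‖ ≤ δ := by
  obtain ⟨x₀, hx₀, hax₀⟩ := hne
  obtain ⟨R, hR0, hR⟩ := hB.exists_pos_norm_le
  have : Nonempty B := ⟨⟨x₀, hx₀⟩⟩
  let M : ℝ := ‖P‖ * R
  have hM : 0 ≤ M := by positivity
  have hPM : ∀ x ∈ B, ‖P x‖ ≤ M := fun x hx => P.le_of_opNorm_le_of_le le_rfl (hR x hx)
  have hφM : ∀ (φ : StrongDual ℝ K), ∀ x ∈ B, |φ (P x)| ≤ M * ‖φ‖ := fun φ x hx => by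
    rw [mul_comm]; exact φ.le_of_opNorm_le_of_le le_rfl (hPM x hx)
  let p : StrongDual ℝ K → ℝ := fun φ => ⨆ x : B, (f x + φ (P x))
  have hbdd : ∀ φ : StrongDual ℝ K, BddAbove (Set.range fun x : B => f x + φ (P x)) := by
    intro φ
    refine ⟨‖f‖ * R + M * ‖φ‖, ?_⟩
    rintro _ ⟨x, rfl⟩
    have h1 : |f x| ≤ ‖f‖ * R := f.le_of_opNorm_le_of_le le_rfl (hR x x.2)
    exact add_le_add ((le_abs_self _).trans h1) ((le_abs_self _).trans (hφM φ x x.2))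
  have hle : ∀ φ : StrongDual ℝ K, ∀ x ∈ B, f x + φ (P x) ≤ p φ :=
    fun φ x hx => le_ciSup (hbdd φ) ⟨x, hx⟩
  have hlip : LipschitzWith (Real.toNNReal M) p := by
    refine LipschitzWith.of_le_add_mul' M fun φ ψ => ciSup_le fun x => ?_
    have h1 := hφM (φ - ψ) x x.2
    have h2 := (le_abs_self _).trans h1
    rw [dist_eq_norm]
    simp only [sub_apply] at h2
    linarith [hle ψ x x.2]
  let _ : MeasurableSpace (StrongDual ℝ K) := borel _
  have : BorelSpace (StrongDual ℝ K) := ⟨rfl⟩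
  have hdense : Dense {φ | DifferentiableAt ℝ p φ} :=
    MeasureTheory.Measure.dense_of_ae
      (hlip.ae_differentiableAt (μ := (Module.finBasis ℝ (StrongDual ℝ K)).addHaar))
  set γ := f x₀ - a with hγ
  have hγ0 : 0 < γ := by simpa [hγ] using hax₀
  -- With `M` bounding `P` on `B`, this makes `φ ∘ P` vary by less than `γ / 2` over `B`, so with `β
  -- ≤ γ / 4` the new cap stays inside the old one.
  obtain ⟨φ, hφ, hφ0⟩ := hdense.exists_dist_lt 0 (show 0 < γ / (4 * (M + 1)) by positivity)
  rw [dist_zero_left, lt_div_iff₀ (by positivity)] at hφ0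
  have hd := (DifferentiableAt.hasFDerivAt hφ).isLittleO.def (show 0 < δ / 4 by linarith)
  obtain ⟨r, hr, hd⟩ := Metric.eventually_nhds_iff_ball.1 hd
  set L := fderiv ℝ p φ
  set s := r / 2 with hs
  have hs0 : 0 < s := by linarith
  have hup : ∀ u : StrongDual ℝ K, ‖u‖ ≤ s → p (φ + u) ≤ p φ + L u + δ / 4 * s := by
    intro u hu
    have h1 := hd (φ + u) (by simp only [Metric.mem_ball, dist_self_add_left]; linarith)
    rw [add_sub_cancel_left] at h1
    have h2 := (le_abs_self _).trans h1
    have : δ / 4 * ‖u‖ ≤ δ / 4 * s := by gcongr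
    linarith
  set β := min (δ / 4 * s) (γ / 4)
  have hβ0 : 0 < β := by positivity
  have hβ1 : β ≤ δ / 4 * s := min_le_left _ _
  have hβ2 : β ≤ γ / 4 := min_le_right _ _
  refine ⟨f + φ.comp P, p φ - β, ?_, ?_, ?_⟩
  · obtain ⟨x, hx⟩ := exists_lt_of_lt_ciSup (show p φ - β < ⨆ x : B, (f x + φ (P x)) from
      sub_lt_self _ hβ0)
    exact ⟨x, x.2, hx⟩
  · rintro x ⟨hx, hxp⟩
    refine ⟨hx, ?_⟩
    have hxp' : p φ - β < f x + φ (P x) := hxp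
    have h1 := abs_le.1 (hφM φ x hx)
    have h2 := abs_le.1 (hφM φ x₀ hx₀)
    have h3 := hle φ x₀ hx₀
    have h4 := norm_nonneg φ
    nlinarith
  · rintro x ⟨hx, hxp⟩ y ⟨hy, hyp⟩
    have hxp' : p φ - β < f x + φ (P x) := hxp
    have hyp' : p φ - β < f y + φ (P y) := hyp
    -- Testing `p` at `φ + s • h` with `x` and at `φ - s • h` with `y`, the derivative terms cancel
    -- on adding, leaving `s * ‖P x - P y‖ ≤ 2 * β + s * δ / 2`.
    obtain ⟨h, hh1, hh⟩ := exists_dual_vector'' ℝ (P x - P y)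
    have hsh : ‖s • h‖ ≤ s := by
      rw [norm_smul, Real.norm_of_nonneg hs0.le]; nlinarith
    have h1 := hup (s • h) hsh
    have h2 := hup (-(s • h)) (by rwa [norm_neg])
    have h3 := hle (φ + s • h) x hx
    have h4 := hle (φ + -(s • h)) y hy
    simp only [add_apply, neg_apply,
      smul_apply, smul_eq_mul, map_neg] at h1 h2 h3 h4
    have h5 : s * ‖P x - P y‖ ≤ s * δ := by
      have : h (P x) - h (P y) = ‖P x - P y‖ := by simpa using hh
      rw [← this]
      linarith
    exact le_of_mul_le_mul_left h5 hs0

theorem exists_containsCapCombination_near_of_finiteDimensional [FiniteDimensional ℝ K]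
    {B : Set E} (hB : Bornology.IsBounded B) (hBc : Convex ℝ B) (P : E →L[ℝ] K) {c : E}
    (hc : c ∈ B) {δ : ℝ} (hδ : 0 < δ) :
    ∃ T ⊆ B, ContainsCapCombination B T ∧ ∀ x ∈ T, ‖P x - P c‖ ≤ δ := by
  refine exists_containsCapCombination_near hBc P (fun g a hne δ hδ => ?_) hc hδ
  obtain ⟨f', a', ⟨y, hy⟩, hsub, hosc⟩ := exists_cap_norm_sub_le hB P hne hδ
  exact ⟨_, hsub, containsCapCombination_cap ⟨y, hy⟩, P y, fun x hx => hosc x hx y hy⟩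

/-- A version of Bourgain's lemma for the intersection of three caps. -/
theorem containsCapCombination_cap_cap_cap {B : Set E} (hB : Bornology.IsBounded B)
    (hBc : Convex ℝ B) {f g h : StrongDual ℝ E} {a b c : ℝ}
    (hne : (cap (cap (cap B f a) g b) h c).Nonempty) :
    ContainsCapCombination B (cap (cap (cap B f a) g b) h c) := by
  obtain ⟨x₀, ⟨⟨hx₀, ha⟩, hb⟩, hc⟩ := hne
  obtain ⟨T, hTB, hT, hclose⟩ := exists_containsCapCombination_near_of_finiteDimensional hB hBc
    (f.prod (g.prod h)) hx₀
    (show 0 < min (f x₀ - a) (min (g x₀ - b) (h x₀ - c)) / 2 by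
      have h1 := sub_pos.2 ha
      have h2 := sub_pos.2 hb
      have h3 := sub_pos.2 hc
      positivity)
  refine hT.mono fun x hx => ?_
  have hm := sub_pos.2 ha
  have hm2 := sub_pos.2 hb
  have hm3 := sub_pos.2 hc
  have := hclose x hx
  simp only [ContinuousLinearMap.prod_apply, Prod.mk_sub_mk, Prod.norm_mk, sup_le_iff,
    Real.norm_eq_abs] at this
  obtain ⟨h1, h2, h3⟩ := this
  have e1 : min (f x₀ - a) (min (g x₀ - b) (h x₀ - c)) ≤ f x₀ - a := min_le_left _ _
  have e2 : min (f x₀ - a) (min (g x₀ - b) (h x₀ - c)) ≤ g x₀ - b :=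
    (min_le_right _ _).trans (min_le_left _ _)
  have e3 : min (f x₀ - a) (min (g x₀ - b) (h x₀ - c)) ≤ h x₀ - c :=
    (min_le_right _ _).trans (min_le_right _ _)
  exact ⟨⟨⟨hTB hx, by linarith [(abs_le.1 h1).1]⟩, by linarith [(abs_le.1 h2).1]⟩,
    by linarith [(abs_le.1 h3).1]⟩

/-! ### From caps to slices -/

theorem slice_eq_cap (C : Set E) (f : StrongDual ℝ E) (α : ℝ) :
    slice C f α = cap C f (sSup (f '' C) - α) := rfl

theorem slice_nonempty {C : Set E} (hC : C.Nonempty) (f : StrongDual ℝ E) {α : ℝ} (hα : 0 < α) :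
    (slice C f α).Nonempty := by
  obtain ⟨_, ⟨x, hx, rfl⟩, h⟩ := exists_lt_of_lt_csSup (hC.image f) (sub_lt_self _ hα)
  exact ⟨x, hx, h⟩

theorem isConvexCombinationOfSlices_minkowskiSum {C : Set E} {ι : Type*} [Fintype ι] {w : ι → ℝ}
    {S : ι → Set E} (hw : ∀ i, 0 ≤ w i) (hw1 : ∑ i, w i = 1) (hS : ∀ i, IsSlice C (S i)) :
    IsConvexCombinationOfSlices C (minkowskiSum w S) := by
  let e := (Fintype.equivFin ι).symm
  refine ⟨Fintype.card ι, w ∘ e, S ∘ e, fun i => hw _, (e.sum_comp w).trans hw1,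
    fun i => hS _, ?_⟩
  ext z
  constructor
  · rintro ⟨x, hx, rfl⟩
    exact ⟨x ∘ e, fun i => hx _, (e.sum_comp fun i => w i • x i).symm⟩
  · rintro ⟨x, hx, rfl⟩
    refine ⟨x ∘ e.symm, fun i => by simpa using hx (e.symm i), ?_⟩
    rw [← e.sum_comp]
    simp

theorem exists_isSlice_subset_cap [Nontrivial E] {C : Set E} (hC : Bornology.IsBounded C)
    {f : StrongDual ℝ E} {a : ℝ} (hne : (cap C f a).Nonempty) :
    ∃ S ⊆ cap C f a, IsSlice C S := by
  obtain ⟨x, hx, hax⟩ := hne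
  -- For `f = 0` the nonempty cap is all of `C`, so a slice by any nonzero functional lies in it.
  by_cases hf : f = 0
  · obtain ⟨y, hy⟩ := exists_ne (0 : E)
    obtain ⟨g, -, hg⟩ := exists_dual_vector'' ℝ y
    refine ⟨slice C g 1, fun z hz => ⟨hz.1, by simpa [hf] using hax⟩, g, ?_, 1, one_pos, rfl⟩
    rintro rfl
    simp [eq_comm, hy] at hg
  · have hbdd : BddAbove (f '' C) := (f.lipschitz.isBounded_image hC).bddAbove
    have := le_csSup hbdd ⟨x, hx, rfl⟩
    refine ⟨cap C f a, subset_rfl, f, hf, sSup (f '' C) - a, by linarith, ?_⟩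
    rw [slice_eq_cap, sub_sub_cancel]

theorem ContainsCapCombination.exists_isConvexCombinationOfSlices [Nontrivial E] {C T : Set E}
    (hC : Bornology.IsBounded C) (h : ContainsCapCombination C T) :
    ∃ S ⊆ T, IsConvexCombinationOfSlices C S := by
  obtain ⟨ι, _, w, f, a, hw, hw1, hne, hT⟩ := h
  choose S hSsub hS using fun i => exists_isSlice_subset_cap hC (hne i)
  refine ⟨_, Set.Subset.trans ?_ hT, isConvexCombinationOfSlices_minkowskiSum hw hw1 hS⟩
  rintro _ ⟨x, hx, rfl⟩
  exact ⟨x, fun i => hSsub i (hx i), rfl⟩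

/-! ### Strongly regular targets -/

theorem exists_containsCapCombination_near_of_stronglyRegularSpace
    (hZ : StronglyRegularSpace Z) {B : Set E} (hB : Bornology.IsBounded B) (hBc : Convex ℝ B)
    (q : E →L[ℝ] Z) {f : StrongDual ℝ E} {a : ℝ} {c : E} (hc : c ∈ cap B f a) {δ : ℝ}
    (hδ : 0 < δ) :
    ∃ T ⊆ cap B f a, ContainsCapCombination B T ∧ ∀ x ∈ T, ‖q x - q c‖ ≤ δ := by
  refine exists_containsCapCombination_near (convex_cap hBc f a) q (fun g b hne δ hδ => ?_) hc hδ
  set S := cap (cap B f a) (g.comp q) b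
  have hSc : Convex ℝ S := convex_cap (convex_cap hBc f a) _ _
  have hSb : Bornology.IsBounded S := hB.subset fun x hx => hx.1.1
  set D := closure (q '' S)
  have hDb : Bornology.IsBounded D := (q.lipschitz.isBounded_image hSb).closure
  have hDc : Convex ℝ D := (hSc.linear_image q.toLinearMap).closure
  have hSD : ∀ x ∈ S, q x ∈ D := fun x hx => subset_closure ⟨x, hx, rfl⟩
  have hDne : D.Nonempty := (hne.image q).closure
  rcases D.subsingleton_or_nontrivial with hD | hD
  · obtain ⟨y, hy⟩ := hne
    -- A trivial third cap makes the three-cap lemma apply to `S`.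
    have hcap : cap S (0 : StrongDual ℝ E) (-1) = S := by ext; simp [cap]
    refine ⟨S, subset_rfl, ?_, q y, fun x hx => ?_⟩
    · rw [← hcap]
      exact containsCapCombination_cap_cap_cap hB hBc (hcap.symm ▸ ⟨y, hy⟩ : (cap S _ _).Nonempty)
    · simpa [hD (hSD x hx) (hSD y hy)] using hδ.le
  · obtain ⟨-, -, -, hreg⟩ := hZ D isClosed_closure hDb hDc
    obtain ⟨_, ⟨n, w, R, hw, hw1, hR, rfl⟩, hdiam⟩ :=
      hreg D subset_rfl hD isClosed_closure hDc δ hδ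
    choose h _ α hα hR using hR
    have hcapne : ∀ i, (cap S ((h i).comp q) (sSup (h i '' D) - α i)).Nonempty := by
      intro i
      obtain ⟨z, hzD, hz⟩ := slice_nonempty hDne (h i) (hα i)
      -- A slice of the closure is relatively open, so it already meets `q '' S`.
      obtain ⟨_, hx, x, hxS, rfl⟩ := mem_closure_iff.1 hzD _
        (isOpen_lt continuous_const (h i).continuous) hz
      exact ⟨x, hxS, hx⟩
    set T := minkowskiSum w fun i => cap S ((h i).comp q) (sSup (h i '' D) - α i)
    have hT : ContainsCapCombination B T := .minkowskiSum hw hw1 fun i =>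
      containsCapCombination_cap_cap_cap hB hBc (hcapne i)
    have hqT : ∀ x ∈ T, q x ∈ minkowskiSum w R := by
      rintro _ ⟨x, hx, rfl⟩
      refine ⟨fun i => q (x i), fun i => ?_, by simp⟩
      rw [hR i]
      exact ⟨hSD _ (hx i).1, (hx i).2⟩
    have hbdd : Bornology.IsBounded (minkowskiSum w R) :=
      hDb.subset (minkowskiSum_subset_of_convex hDc hw hw1 fun i => by
        rw [hR i]; exact fun x hx => hx.1)
    obtain ⟨y, hy⟩ := hT.nonempty
    refine ⟨T, minkowskiSum_subset_of_convex hSc hw hw1 fun i x hx => hx.1, hT, q y,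
      fun x hx => ?_⟩
    rw [← dist_eq_norm]
    exact (Metric.dist_le_diam_of_mem hbdd (hqT x hx) (hqT y hy)).trans hdiam.le

/-! ### Diameter two and approximation by the subspace -/

theorem exists_lt_norm_sub_of_diam_eq_two {F : Type*} [NormedAddCommGroup F] {T : Set F}
    (hT : Metric.diam T = 2) {ε : ℝ} (hε : 0 < ε) :
    ∃ x ∈ T, ∃ y ∈ T, 2 - ε < ‖x - y‖ := by
  by_contra! h
  have hne : T.Nonempty := by
    by_contra hn
    simp [Set.not_nonempty_iff_eq_empty.1 hn] at hT
  have := Metric.diam_le_of_forall_dist_le_of_nonempty hne fun x hx y hy =>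
    (dist_eq_norm x y).trans_le (h x hx y hy)
  linarith

theorem diam_eq_two_of_exists_lt_norm_sub {F : Type*} [NormedAddCommGroup F] {T : Set F}
    (hT : T ⊆ Metric.closedBall 0 1)
    (h : ∀ ε > 0, ∃ x ∈ T, ∃ y ∈ T, 2 - ε < ‖x - y‖) : Metric.diam T = 2 := by
  apply le_antisymm
  · refine (Metric.diam_mono hT Metric.isBounded_closedBall).trans ?_
    simpa using Metric.diam_closedBall (x := (0 : F)) zero_le_one
  · refine le_of_forall_pos_lt_add fun ε hε => ?_
    obtain ⟨x, hx, y, hy, hxy⟩ := h ε hε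
    have := Metric.dist_le_diam_of_mem (Metric.isBounded_closedBall.subset hT) hx hy
    rw [dist_eq_norm] at this
    linarith

theorem exists_lt_norm_sub_of_forall_exists_norm_sub_le {Y : Submodule ℝ E} {R : Set E} {T : Set Y}
    (hR : Metric.diam R = 2) {ε : ℝ} (hε : 0 < ε) (h : ∀ x ∈ R, ∃ y ∈ T, ‖x - y‖ ≤ ε / 4) :
    ∃ y ∈ T, ∃ y' ∈ T, 2 - ε < ‖y - y'‖ := by
  obtain ⟨x, hx, x', hx', hd⟩ := exists_lt_norm_sub_of_diam_eq_two hR (half_pos hε)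
  obtain ⟨y, hy, hxy⟩ := h x hx
  obtain ⟨y', hy', hxy'⟩ := h x' hx'
  refine ⟨y, hy, y', hy', ?_⟩
  have h1 : ‖x - x'‖ ≤ ‖x - y‖ + ‖(y : E) - y'‖ + ‖x' - y'‖ := by
    rw [norm_sub_rev x' y']
    refine le_trans (le_of_eq ?_) norm_add₃_le
    congr 1
    abel
  have h2 : ‖(y : E) - y'‖ = ‖y - y'‖ := rfl
  linarith

/-- Subtracting a representative of norm below `δ` lands in `Y` with norm at most `1 + δ`. Rescaling
into the unit ball costs at most another `δ`. -/
theorem exists_mem_closedBall_norm_sub_le (Y : Submodule ℝ E) [IsClosed (Y : Set E)] {x : E}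
    (hx : ‖x‖ ≤ 1) {δ : ℝ} (hδ : ‖(Submodule.Quotient.mk x : E ⧸ Y)‖ < δ) :
    ∃ y : Y, ‖y‖ ≤ 1 ∧ ‖x - y‖ ≤ 2 * δ := by
  have hδ0 : 0 < δ := (norm_nonneg _).trans_lt hδ
  obtain ⟨m, hm, hmδ⟩ := Submodule.Quotient.norm_mk_lt (Submodule.Quotient.mk x : E ⧸ Y)
    (sub_pos.2 hδ)
  rw [add_sub_cancel] at hmδ
  have hy : x - m ∈ Y := (Submodule.Quotient.eq Y).1 hm.symm
  have hn : ‖x - m‖ ≤ 1 + δ := (norm_sub_le _ _).trans (by linarith)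
  have h1 : 0 < 1 + δ := by linarith
  refine ⟨(1 + δ)⁻¹ • ⟨x - m, hy⟩, ?_, ?_⟩
  · rw [norm_smul, Real.norm_of_nonneg (by positivity), inv_mul_le_one₀ h1]
    exact hn
  · have e : x - (1 + δ)⁻¹ • (x - m) = m + (δ * (1 + δ)⁻¹) • (x - m) := by
      have : δ * (1 + δ)⁻¹ = 1 - (1 + δ)⁻¹ := by field_simp; ring
      rw [this, sub_smul, one_smul]; abel
    change ‖x - (1 + δ)⁻¹ • (x - m)‖ ≤ _
    rw [e]
    calc _ ≤ ‖m‖ + ‖(δ * (1 + δ)⁻¹) • (x - m)‖ := norm_add_le _ _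
      _ ≤ δ + δ * (1 + δ)⁻¹ * (1 + δ) := by
        rw [norm_smul, Real.norm_of_nonneg (by positivity)]
        gcongr
      _ = 2 * δ := by field_simp; ring

end DiameterTwo

namespace DiameterTwo

/-! ### The three inheritance results -/

variable {X : Type*} [NormedAddCommGroup X] [NormedSpace ℝ X] (Y : Submodule ℝ X)

theorem SliceD2P.of_projection (hX : SliceD2P X) (π : X →L[ℝ] Y) (hπ : ∀ y : Y, π y = y)
    (hn : ‖π‖ = 1) [FiniteDimensional ℝ (LinearMap.ker (π : X →ₗ[ℝ] Y))] : SliceD2P Y := by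
  rintro _ ⟨f, hf, α, hα, rfl⟩
  let P : X →L[ℝ] LinearMap.ker (π : X →ₗ[ℝ] Y) :=
    (ContinuousLinearMap.id ℝ X - Y.subtypeL.comp π).codRestrict _ fun x => by simp [hπ]
  have : Nontrivial X := by
    obtain ⟨y, hy⟩ := DFunLike.ne_iff.1 hf
    exact ⟨(y : X), 0, fun h => hy (by simp [Subtype.ext (a2 := (0 : Y)) h])⟩
  have hne : (cap (Metric.closedBall (0 : X) 1) (f.comp π)
      (sSup (f '' Metric.closedBall 0 1) - α)).Nonempty := by
    obtain ⟨y, hy, hfy⟩ := slice_nonempty (C := Metric.closedBall (0 : Y) 1) ⟨0, by simp⟩ f hα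
    exact ⟨y, by simpa using hy, by simpa [hπ] using hfy⟩
  refine diam_eq_two_of_exists_lt_norm_sub (fun y hy => hy.1) fun ε hε => ?_
  obtain ⟨g, b, hgb, hsub, hosc⟩ := exists_cap_norm_sub_le Metric.isBounded_closedBall P hne
    (show 0 < ε / 2 by linarith)
  obtain ⟨S, hS, hslice⟩ := exists_isSlice_subset_cap Metric.isBounded_closedBall hgb
  obtain ⟨x, hx, y, hy, hxy⟩ := exists_lt_norm_sub_of_diam_eq_two (hX S hslice)
    (show 0 < ε / 2 by linarith)
  have hmem : ∀ z ∈ S, π z ∈ slice (Metric.closedBall (0 : Y) 1) f α := fun z hz => by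
    obtain ⟨hz1, hz2⟩ := hsub (hS hz)
    refine ⟨?_, hz2⟩
    rw [mem_closedBall_zero_iff] at hz1 ⊢
    exact (π.le_of_opNorm_le_of_le hn.le hz1).trans (by norm_num)
  refine ⟨_, hmem x hx, _, hmem y hy, ?_⟩
  have h1 : ‖(x - π x) - (y - π y)‖ ≤ ε / 2 := hosc x (hS hx) y (hS hy)
  have h2 : ‖x - y‖ ≤ ‖((x - π x) - (y - π y) : X)‖ + ‖((π x - π y : Y) : X)‖ := by
    refine le_trans (le_of_eq ?_) (norm_add_le _ _)
    congr 1
    push_cast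
    abel
  have h3 : ‖((π x - π y : Y) : X)‖ = ‖π x - π y‖ := rfl
  linarith

theorem exists_weak_nhds {U : Set (WeakSpace ℝ X)} (hU : IsOpen U) {x : X}
    (hx : toWeakSpace ℝ X x ∈ U) :
    ∃ s : Finset (StrongDual ℝ X), ∃ ε > 0,
      ∀ y, (∀ f ∈ s, |f y - f x| < ε) → toWeakSpace ℝ X y ∈ U := by
  obtain ⟨V, hV, rfl⟩ := isOpen_induced_iff.1 hU
  have hmem := hV.mem_nhds hx
  rw [nhds_pi, Filter.mem_pi'] at hmem
  obtain ⟨s, t, ht, hsV⟩ := hmem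
  have hev : ∀ᶠ ε in nhdsWithin (0 : ℝ) (Set.Ioi 0),
      ∀ f ∈ s, Metric.ball (f x) ε ⊆ t f := by
    rw [Filter.eventually_all_finset]
    intro f _
    obtain ⟨r, hr, hrt⟩ := Metric.mem_nhds_iff.1 (ht f)
    filter_upwards [Ioo_mem_nhdsGT hr] with ε hε
    exact (Metric.ball_subset_ball hε.2.le).trans hrt
  obtain ⟨ε, hε, hε0⟩ := (hev.and self_mem_nhdsWithin).exists
  exact ⟨s, ε, hε0, fun y hy => hsV fun f hf => hε f hf (hy f hf)⟩

theorem isOpen_weak_abs_sub_lt (f : StrongDual ℝ X) (a ε : ℝ) :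
    IsOpen {x : WeakSpace ℝ X | |f ((toWeakSpace ℝ X).symm x) - a| < ε} := by
  have hf : Continuous fun x : WeakSpace ℝ X => f ((toWeakSpace ℝ X).symm x) :=
    WeakBilin.eval_continuous (topDualPairing ℝ X).flip f
  exact isOpen_lt (hf.sub continuous_const).abs continuous_const

/-- In coordinates `q` is a finite tuple of functionals, hence weak-to-norm continuous. -/
theorem isOpen_weak_norm_lt {K : Type*} [NormedAddCommGroup K] [NormedSpace ℝ K]
    [FiniteDimensional ℝ K] (q : X →L[ℝ] K) (δ : ℝ) :
    IsOpen {x : WeakSpace ℝ X | ‖q ((toWeakSpace ℝ X).symm x)‖ < δ} := by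
  have hq : Continuous fun x : WeakSpace ℝ X => q ((toWeakSpace ℝ X).symm x) := by
    let e := (Module.finBasis ℝ K).equivFunL
    rw [← e.toHomeomorph.comp_continuous_iff]
    refine continuous_pi fun i => ?_
    exact WeakBilin.eval_continuous (topDualPairing ℝ X).flip
      (((ContinuousLinearMap.proj (R := ℝ) (φ := fun _ => ℝ) i).comp
        (e : K →L[ℝ] Fin _ → ℝ)).comp q)
  exact isOpen_lt hq.norm continuous_const

variable [IsClosed (Y : Set X)]

theorem D2P.of_finiteDimensional_quotient (hX : D2P X) [FiniteDimensional ℝ (X ⧸ Y)] :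
    D2P Y := by
  rintro U hU ⟨y₀, hy₀U, hy₀⟩
  refine diam_eq_two_of_exists_lt_norm_sub Set.inter_subset_right fun ε hε => ?_
  obtain ⟨s, η, hη, hs⟩ := exists_weak_nhds hU hy₀U
  choose F hF _ using fun f : StrongDual ℝ Y => exists_extension_norm_eq Y f
  have hev : ∀ᶠ δ in nhdsWithin (0 : ℝ) (Set.Ioi 0),
      δ < ε / 8 ∧ ∀ f ∈ s, ‖F f‖ * (2 * δ) < η / 2 := by
    refine (Filter.Eventually.filter_mono nhdsWithin_le_nhds
      (eventually_lt_nhds (by positivity))).and ?_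
    rw [Filter.eventually_all_finset]
    intro f _
    refine Filter.Eventually.filter_mono nhdsWithin_le_nhds ?_
    have : Continuous fun δ : ℝ => ‖F f‖ * (2 * δ) := by fun_prop
    exact this.continuousAt.eventually_lt continuousAt_const (by simpa using hη)
  obtain ⟨δ, ⟨hδε, hδ⟩, hδ0⟩ := (hev.and self_mem_nhdsWithin).exists
  let W : Set (WeakSpace ℝ X) :=
    (⋂ f ∈ s, {x | |F f ((toWeakSpace ℝ X).symm x) - F f y₀| < η / 2}) ∩
      {x | ‖Y.mkQL ((toWeakSpace ℝ X).symm x)‖ < δ}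
  have hW : IsOpen W := by
    refine (isOpen_biInter_finset fun f _ => isOpen_weak_abs_sub_lt _ _ _).inter ?_
    exact isOpen_weak_norm_lt _ _
  have hne : (toWeakSpace ℝ X ⁻¹' W ∩ Metric.closedBall (0 : X) 1).Nonempty := by
    refine ⟨y₀, ⟨?_, ?_⟩, by simpa using hy₀⟩
    · simp [hη]
    · have h0 : Y.mkQL (y₀ : X) = 0 := by simp
      change ‖Y.mkQL (y₀ : X)‖ < δ
      rwa [h0, norm_zero]
  have key : ∀ x ∈ toWeakSpace ℝ X ⁻¹' W ∩ Metric.closedBall (0 : X) 1,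
      ∃ y ∈ toWeakSpace ℝ Y ⁻¹' U ∩ Metric.closedBall (0 : Y) 1, ‖x - y‖ ≤ 2 * δ := by
    rintro x ⟨⟨hxs, hxq⟩, hx⟩
    obtain ⟨y, hy, hxy⟩ := exists_mem_closedBall_norm_sub_le Y (mem_closedBall_zero_iff.1 hx) hxq
    refine ⟨y, ⟨hs y fun f hf => ?_, mem_closedBall_zero_iff.2 hy⟩, hxy⟩
    have h1 : |F f x - F f y₀| < η / 2 := Set.mem_iInter₂.1 hxs f hf
    have h2 : |F f (x - y)| ≤ ‖F f‖ * (2 * δ) := (F f).le_of_opNorm_le_of_le le_rfl hxy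
    have h3 := hδ f hf
    rw [← hF, ← hF]
    rw [map_sub] at h2
    rw [abs_lt] at h1 ⊢
    rw [abs_le] at h2
    constructor <;> linarith [h1.1, h1.2, h2.1, h2.2]
  exact exists_lt_norm_sub_of_forall_exists_norm_sub_le (hX W hW hne) hε fun x hx => by
    obtain ⟨y, hy, hxy⟩ := key x hx
    exact ⟨y, hy, by linarith⟩

theorem StrongD2P.of_stronglyRegular_quotient (hX : StrongD2P X)
    (hq : StronglyRegularSpace (X ⧸ Y)) : StrongD2P Y := by
  rintro _ ⟨n, w, S, hw, hw1, hS, rfl⟩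
  choose f hf α hα hS using hS
  have hSB : ∀ i, S i ⊆ Metric.closedBall 0 1 := fun i => by rw [hS i]; exact fun y hy => hy.1
  have : Nontrivial X := by
    have hn : n ≠ 0 := by
      rintro rfl
      simp at hw1
    obtain ⟨y, hy⟩ := DFunLike.ne_iff.1 (hf ⟨0, Nat.pos_of_ne_zero hn⟩)
    exact ⟨(y : X), 0, fun h => hy (by simp [Subtype.ext (a2 := (0 : Y)) h])⟩
  refine diam_eq_two_of_exists_lt_norm_sub
    (minkowskiSum_subset_of_convex (convex_closedBall 0 1) hw hw1 hSB) fun ε hε => ?_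
  have key : ∀ i, ∃ T ⊆ Metric.closedBall (0 : X) 1,
      ContainsCapCombination (Metric.closedBall (0 : X) 1) T ∧
        ∀ x ∈ T, ∃ y ∈ S i, ‖x - y‖ ≤ ε / 4 := by
    intro i
    obtain ⟨F, hF, -⟩ := exists_extension_norm_eq Y (f i)
    obtain ⟨y₀, hy₀, hfy₀⟩ := slice_nonempty (C := Metric.closedBall (0 : Y) 1) ⟨0, by simp⟩
      (f i) (half_pos (hα i))
    -- Moving by `2 * δ` costs at most `ε / 4` in distance and `α i / 4` in `F`, within the slack `α
    -- i / 2` kept in the cap.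
    set δ := min (ε / 8) (α i / (8 * (‖F‖ + 1))) with hδ
    have hαi := hα i
    have hδ0 : 0 < δ := by positivity
    have hδ1 : δ ≤ ε / 8 := min_le_left _ _
    have hδ2 : δ * (8 * (‖F‖ + 1)) ≤ α i :=
      (le_div_iff₀ (by positivity)).1 (min_le_right _ _)
    obtain ⟨T, hTC, hT, hTq⟩ := exists_containsCapCombination_near_of_stronglyRegularSpace hq
      Metric.isBounded_closedBall (convex_closedBall (0 : X) 1) Y.mkQL
      (f := F) (a := sSup (f i '' Metric.closedBall 0 1) - α i / 2) (c := (y₀ : X))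
      ⟨by simpa using hy₀, by rwa [hF]⟩ (half_pos hδ0)
    refine ⟨T, fun x hx => (hTC hx).1, hT, fun x hx => ?_⟩
    obtain ⟨hx1, hx2⟩ := hTC hx
    have hxq : ‖(Submodule.Quotient.mk x : X ⧸ Y)‖ < δ := by
      have h1 := hTq x hx
      have h2 : Y.mkQL (y₀ : X) = 0 := by simp
      rw [h2, sub_zero] at h1
      exact lt_of_le_of_lt h1 (half_lt_self hδ0)
    obtain ⟨y, hy, hxy⟩ := exists_mem_closedBall_norm_sub_le Y (mem_closedBall_zero_iff.1 hx1) hxq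
    refine ⟨y, ?_, by linarith⟩
    rw [hS i]
    refine ⟨mem_closedBall_zero_iff.2 hy, ?_⟩
    have h2 : |F (x - y)| ≤ ‖F‖ * (2 * δ) := F.le_of_opNorm_le_of_le le_rfl hxy
    rw [map_sub, abs_le] at h2
    rw [← hF]
    nlinarith [h2.1, h2.2]
  choose T hTB hT hTS using key
  obtain ⟨R, hRsub, hR⟩ := (ContainsCapCombination.minkowskiSum hw hw1
    hT).exists_isConvexCombinationOfSlices Metric.isBounded_closedBall
  have approx : ∀ z ∈ minkowskiSum w T, ∃ y ∈ minkowskiSum w S, ‖z - y‖ ≤ ε / 4 := by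
    rintro _ ⟨x, hx, rfl⟩
    choose y hy hxy using fun i => hTS i (x i) (hx i)
    refine ⟨_, ⟨y, hy, rfl⟩, ?_⟩
    have e : ∑ i, w i • x i - ((∑ i, w i • y i : Y) : X) = ∑ i, w i • (x i - y i) := by
      simp [smul_sub]
    rw [e, ← mem_closedBall_zero_iff]
    exact (convex_closedBall (0 : X) (ε / 4)).sum_mem (fun i _ => hw i) hw1
      fun i _ => mem_closedBall_zero_iff.2 (hxy i)
  exact exists_lt_norm_sub_of_forall_exists_norm_sub_le (hX R hR) hε
    fun z hz => approx z (hRsub hz)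

end DiameterTwo

theorem theorem2p2 {X : Type*} [NormedAddCommGroup X] [NormedSpace ℝ X] [CompleteSpace X]
    (Y : Submodule ℝ X) [IsClosed (Y : Set X)] :
    (DiameterTwo.SliceD2P X →
      (∃ π : X →L[ℝ] Y, (∀ y : Y, π (y : X) = y) ∧ ‖π‖ = 1 ∧
        FiniteDimensional ℝ (LinearMap.ker (π : X →ₗ[ℝ] Y))) →
      DiameterTwo.SliceD2P Y) ∧
    (DiameterTwo.D2P X → FiniteDimensional ℝ (X ⧸ Y) → DiameterTwo.D2P Y) ∧
    (DiameterTwo.StrongD2P X → DiameterTwo.StronglyRegularSpace (X ⧸ Y) →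
      DiameterTwo.StrongD2P Y) := by
  refine ⟨fun hX => ?_, fun hX _ => hX.of_finiteDimensional_quotient Y,
    fun hX hq => hX.of_stronglyRegular_quotient Y hq⟩
  rintro ⟨π, hπ, hn, _⟩
  exact hX.of_projection Y π hπ hn
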